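/- **Setting.** Fix constants $k,d\in\mathbb N$. An instance of MST verification on $n\ge 1$ nodes consists of a connected simple graph $G=(V,E)$ with $|V|=n$, pairwise distinct node identifiers $\mathrm{ID}(v)\in\{0,\dots,n^k\}$, integer edge weights $w:E\to\mathbb Z$ with $|w(e)|\le n^d$, and an arbitrary set $T\subseteq E$ of marked edges. The input $I(v)$ of a node $v$ lists, for each edge $e=\{v,u\}$ incident to $v$, the identifier of $u$, the weight $w(e)$, and whether $e\in T$. The instance is a *yes-instance* if $(V,T)$ is a spanning tree of $G$ whose total weight $\sum_{e\in T}w(e)$ is minimum among all spanning trees of $G$. For a function $t:\mathbb N\to\mathbb N$, a *$t$-PLS* (proof labeling scheme of radius $t$) for MST verification is a pair $(\mathrm{Prov},\mathrm{Ver})$. The prover $\mathrm{Prov}$ maps each yes-instance to a labeling $\ell:V\to\{0,1\}^*$. The verifier $\mathrm{Ver}$ is a function that, for a node $v$ of an $n$-node instance with a labeling $\ell$, receives $n$, $\mathrm{ID}(v)$, the subgraph of $G$ induced by the ball $B_{t(n)}(v)=\{u:\mathrm{dist}_G(u,v)\le t(n)\}$ with its identifiers, and $I(u),\ell(u)$ for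 all $u\in B_{t(n)}(v)$, and outputs accept or reject. It is required that - (completeness) on every yes-instance, with the labeling given by $\mathrm{Prov}$, all nodes accept; - (soundness) for every instance and every labeling $\ell:V\to\{0,1\}^*$, if all nodes accept, then the instance is a yes-instance. Its *cost* at $n$ is the maximum length of a label given by $\mathrm{Prov}$ to a node, over all $n$-node yes-instances. **Corollary ($t$-PLS for MST verification).** For all $k,d\in\mathbb N$ there is a constant $C=C(k,d)$ such that for every $t:\mathbb N\to\mathbb N$ with $t(n)\ge 1$ and $t(n)\ge\log_2 n$ for all $n\ge 1$, there is a $t$-PLS for MST verification whose cost at $n$ is at most $C\cdot\lceil \log_2^3 n/t(n)\rceil$ for every $n\ge 1$. -/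

import Mathlib

namespace ProofLabeling

/-- A configuration on `n` nodes: a connected graph on `Fin n`, pairwise distinct node identifiers
in `{0, …, n ^ k}` (i.e. of `O(log n)` bits), and an input at every node. -/
structure Config (Input : Type) (k n : ℕ) where
  graph : SimpleGraph (Fin n)
  connected : graph.Connected
  id : Fin n → ℕ
  id_injective : Function.Injective id
  id_le : ∀ v, id v ≤ n ^ k
  input : Fin n → Input

/-- What a node sees: the number of nodes of the whole graph, its own identifier, the triples
(identifier, input, label) of the nodes in its neighborhood, and the edges of its neighborhood
(as pairs of identifiers). -/
structure View (Input : Type) where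
  size : ℕ
  center : ℕ
  nodes : Set (ℕ × Input × List Bool)
  edges : Set (Sym2 ℕ)

/-- The ball of radius `t` around `v` in the shortest path metric. -/
def Config.ball {Input : Type} {k n : ℕ} (c : Config Input k n) (t : ℕ) (v : Fin n) :
    Set (Fin n) :=
  {u | c.graph.dist v u ≤ t}

/-- The `t`-hop view of the node `v` under the labeling `l`. -/
def Config.view {Input : Type} {k n : ℕ} (c : Config Input k n) (l : Fin n → List Bool)
    (t : ℕ) (v : Fin n) : View Input where
  size := n
  center := c.id v
  nodes := {x | ∃ u ∈ c.ball t v, x = (c.id u, c.input u, l u)}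
  edges := {e | ∃ u ∈ c.ball t v, ∃ w ∈ c.ball t v, c.graph.Adj u w ∧ e = s(c.id u, c.id w)}

/-- A proof labeling scheme with radius `t n` on `n`-node graphs, for the predicate `P` on the
configuration family `F`. The values of `prov` outside `P` are irrelevant. -/
structure PLS {Input : Type} {k : ℕ} (F P : ∀ n, Set (Config Input k n)) (t : ℕ → ℕ) where
  prov : ∀ {n : ℕ}, Config Input k n → Fin n → List Bool
  ver : View Input → Bool
  complete : ∀ {n : ℕ}, ∀ c ∈ P n, ∀ v, ver (c.view (prov c) (t n) v) = true
  sound : ∀ {n : ℕ}, ∀ c ∈ F n, ∀ l : Fin n → List Bool,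
    (∀ v, ver (c.view l (t n) v) = true) → c ∈ P n

/-- The maximal length of a label that the prover assigns on an `n`-node configuration
satisfying the predicate. -/
noncomputable def PLS.cost {Input : Type} {k : ℕ} {F P : ∀ n, Set (Config Input k n)} {t : ℕ → ℕ}
    (S : PLS F P t) (n : ℕ) : ℕ∞ :=
  ⨆ c ∈ P n, ⨆ v : Fin n, ((S.prov c v).length : ℕ∞)

/-- The total weight of the edges of `H`. -/
noncomputable def totalWeight {n : ℕ} (w : Sym2 (Fin n) → ℤ) (H : SimpleGraph (Fin n)) : ℤ :=
  open Classical in ∑ e ∈ H.edgeFinset, w e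

/-- `T` is a spanning tree of `G`. -/
def IsSpanningTree {n : ℕ} (G T : SimpleGraph (Fin n)) : Prop :=
  T ≤ G ∧ T.IsTree

/-- `T` is a spanning tree of `G` of minimum total weight with respect to `w`. -/
def IsMST {n : ℕ} (G : SimpleGraph (Fin n)) (w : Sym2 (Fin n) → ℤ) (T : SimpleGraph (Fin n)) :
    Prop :=
  IsSpanningTree G T ∧ ∀ T', IsSpanningTree G T' → totalWeight w T ≤ totalWeight w T'

/-- The input of a node in MST verification: for each incident edge, the identifier of the other
endpoint, the weight of the edge, and a bit telling whether the edge is marked. -/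
abbrev MSTInput : Type := Finset (ℕ × ℤ × Bool)

/-- The input of the node `u` that encodes the edge weights `w` and the set of marked edges
(the edges of `T`). -/
noncomputable def mstInput {n : ℕ} (G : SimpleGraph (Fin n)) (id : Fin n → ℕ)
    (w : Sym2 (Fin n) → ℤ) (T : SimpleGraph (Fin n)) (u : Fin n) : MSTInput :=
  open Classical in
  (G.neighborFinset u).image fun v => (id v, w s(u, v), decide (T.Adj u v))

/-- The inputs of `c` encode integer edge weights `w` with `|w e| ≤ n ^ d` on the edges of the
graph, together with the marked subgraph `T`. -/
def Encodes (d : ℕ) {k n : ℕ} (c : Config MSTInput k n) (w : Sym2 (Fin n) → ℤ)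
    (T : SimpleGraph (Fin n)) : Prop :=
  (∀ e ∈ c.graph.edgeSet, |w e| ≤ (n : ℤ) ^ d) ∧ T ≤ c.graph ∧
    ∀ u, c.input u = mstInput c.graph c.id w T u

/-- All configurations of MST verification: a weighted graph with an arbitrary marked subgraph. -/
def mstFamily (k d n : ℕ) : Set (Config MSTInput k n) :=
  {c | ∃ w T, Encodes d c w T}

/-- The MST predicate: the marked edges form a minimum spanning tree. (The encoding determines `T`
and the weights of all edges of the graph.) -/
def mstPredicate (k d n : ℕ) : Set (Config MSTInput k n) :=
  {c | ∃ w T, Encodes d c w T ∧ IsMST c.graph w T}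

end ProofLabeling

/-!
A spanning subgraph `T` is a minimum spanning tree if and only if it is a tree and the ends of every
edge of weight `β` of the graph are joined in the forest `T_{≤ β}` of the tree edges of weight at
most `β`. To verify this with views of radius `t`, root `T` and call a node a portal if its depth is
divisible by `s = Θ(t)` and it has a descendant `s - 1` levels below. Paths of length `s - 1` that
descend from distinct portals can be chosen disjoint, so the information of a portal is spread over
`s` labels; and every path of `4 * (s - 1)` tree edges contains a portal.

A portal stores its depth and, for every weight `β`, the identifier of a representative of its
component in `T_{≤ β}` and the distance to that representative. If the representative of the larger
part survives whenever components merge, then each portal changes its representative at most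
`log₂ n` times as `β` grows, so `O(log² n)` bits describe the whole list. An edge of weight `β` is
checked by comparing the representatives of portals near its two ends; pointers along decreasing
distances certify that representatives exist, pointers along decreasing depths certify a root, and
the depths modulo 3 orient the marked edges towards the root, so that there is no cycle.
-/

namespace ProofLabeling

open SimpleGraph

section MinimumSpanningTrees

variable {V α : Type*} [Preorder α] {n : ℕ}

/-- The subgraph `T_{≤ b}` of the edges of `T` of weight at most `b`. -/
def below (T : SimpleGraph V) (w : Sym2 V → α) (b : α) : SimpleGraph V where
  Adj x y := T.Adj x y ∧ w s(x, y) ≤ b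
  symm := ⟨fun _ _ h => ⟨h.1.symm, Sym2.eq_swap ▸ h.2⟩⟩
  loopless := ⟨fun _ h => h.1.ne rfl⟩

theorem below_le (T : SimpleGraph V) (w : Sym2 V → α) (b : α) : below T w b ≤ T :=
  fun _ _ h => h.1

theorem below_mono (T : SimpleGraph V) (w : Sym2 V → α) : Monotone (below T w) :=
  fun _ _ h _ _ hxy => ⟨hxy.1, hxy.2.trans h⟩

theorem reachable_below_of_forall_mem_edges {T : SimpleGraph V} {w : Sym2 V → α} {b : α} {x y : V}
    (p : T.Walk x y) (hp : ∀ e ∈ p.edges, w e ≤ b) : (below T w b).Reachable x y := by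
  refine ⟨p.transfer _ fun e he => ?_⟩
  induction e using Sym2.ind with
  | _ u v => exact ⟨p.edges_subset_edgeSet he, hp _ he⟩

theorem reachable_deleteEdges_of_reachable {G : SimpleGraph V} {a z : V} (h : G.Reachable a z)
    (b : V) :
    (G.deleteEdges {s(a, b)}).Reachable a z ∨ (G.deleteEdges {s(a, b)}).Reachable b z := by
  obtain ⟨p⟩ := h
  induction p using Walk.concatRec with
  | Hnil => exact .inl .rfl
  | @Hconcat a u z p huz ih =>
    by_cases he : s(u, z) = s(a, b)
    · rcases Sym2.eq_iff.1 he with ⟨-, rfl⟩ | ⟨-, rfl⟩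
      exacts [.inr .rfl, .inl .rfl]
    · have hadj : (G.deleteEdges {s(a, b)}).Adj u z := deleteEdges_adj.2 ⟨huz, he⟩
      exact ih.imp (·.trans hadj.reachable) (·.trans hadj.reachable)

theorem isTree_exchange {T : SimpleGraph V} (hT : T.IsTree) {a b x y : V}
    (hxy : ¬ (T.deleteEdges {s(a, b)}).Reachable x y) :
    (T.deleteEdges {s(a, b)} ⊔ edge x y).IsTree := by
  set H := T.deleteEdges {s(a, b)}
  have side (z : V) : H.Reachable a z ∨ H.Reachable b z :=
    reachable_deleteEdges_of_reachable (hT.connected a z) b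
  have hle : H ≤ H ⊔ edge x y := le_sup_left
  have hadj : (H ⊔ edge x y).Reachable x y :=
    Adj.reachable (.inr ((edge_adj ..).2 ⟨.inl ⟨rfl, rfl⟩, fun h => hxy (h ▸ .rfl)⟩))
  have hab : (H ⊔ edge x y).Reachable a b := by
    rcases side x with hx | hx <;> rcases side y with hy | hy
    · exact absurd (hx.symm.trans hy) hxy
    · exact ((hx.mono hle).trans hadj).trans (hy.mono hle).symm
    · exact ((hy.mono hle).trans hadj.symm).trans (hx.mono hle).symm
    · exact absurd (hx.symm.trans hy) hxy
  have all (z : V) : (H ⊔ edge x y).Reachable a z :=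
    (side z).elim (·.mono hle) fun h => hab.trans (h.mono hle)
  have : Nonempty V := ⟨a⟩
  exact ⟨⟨fun u v => (all u).symm.trans (all v)⟩,
    (hT.isAcyclic.anti (deleteEdges_le _)).sup_edge_of_not_reachable hxy⟩

theorem not_reachable_deleteEdges_of_mem_edges {T : SimpleGraph V} (hT : T.IsAcyclic) {x y : V}
    {p : T.Walk x y} (hp : p.IsPath) {e : Sym2 V} (he : e ∈ p.edges) :
    ¬ (T.deleteEdges {e}).Reachable x y := by
  intro hr
  obtain ⟨q, hq⟩ := hr.exists_isPath
  have hpq : p = q.mapLe (deleteEdges_le _) :=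
    congrArg Subtype.val ((hT.subsingleton_path x y).elim ⟨p, hp⟩ ⟨_, hq.mapLe _⟩)
  rw [hpq, Walk.edges_mapLe_eq_edges] at he
  have := q.edges_subset_edgeSet he
  rw [edgeSet_deleteEdges] at this
  exact this.2 rfl

theorem edgeSet_exchange {T : SimpleGraph V} {e : Sym2 V} {x y : V} (hxy : x ≠ y) :
    (T.deleteEdges {e} ⊔ edge x y).edgeSet = insert s(x, y) (T.edgeSet \ {e}) := by
  rw [edgeSet_sup, edgeSet_edge_of_ne hxy, edgeSet_deleteEdges, Set.union_singleton]

theorem totalWeight_eq_sum (w : Sym2 (Fin n) → ℤ) (H : SimpleGraph (Fin n))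
    [Fintype H.edgeSet] : totalWeight w H = ∑ e ∈ H.edgeFinset, w e := by
  unfold totalWeight
  congr!

theorem totalWeight_exchange (w : Sym2 (Fin n) → ℤ) {T : SimpleGraph (Fin n)}
    {e : Sym2 (Fin n)} (he : e ∈ T.edgeSet) {x y : Fin n}
    (hxy : ¬ (T.deleteEdges {e}).Reachable x y) :
    totalWeight w (T.deleteEdges {e} ⊔ edge x y) + w e = totalWeight w T + w s(x, y) := by
  classical
  have hne : x ≠ y := fun h => hxy (h ▸ .rfl)
  have hedges : (T.deleteEdges {e} ⊔ edge x y).edgeFinset =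
      insert s(x, y) (T.edgeFinset.erase e) := by
    apply Finset.coe_injective
    rw [coe_edgeFinset, edgeSet_exchange hne, Finset.coe_insert, Finset.coe_erase, coe_edgeFinset]
  have hnot : s(x, y) ∉ T.edgeFinset.erase e := fun h =>
    hxy (Adj.reachable (deleteEdges_adj.2
      ⟨mem_edgeFinset.1 (Finset.mem_of_mem_erase h), Finset.ne_of_mem_erase h⟩))
  have hsum := Finset.sum_erase_add _ w (mem_edgeFinset.2 he)
  rw [totalWeight_eq_sum, totalWeight_eq_sum, hedges, Finset.sum_insert hnot]
  linarith

theorem IsMST.reachable_below {G T : SimpleGraph (Fin n)} {w : Sym2 (Fin n) → ℤ}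
    (h : IsMST G w T) {x y : Fin n} (hxy : G.Adj x y) :
    (below T w (w s(x, y))).Reachable x y := by
  obtain ⟨⟨hTG, hT⟩, hmin⟩ := h
  obtain ⟨p, hp⟩ := (hT.connected x y).exists_isPath
  refine reachable_below_of_forall_mem_edges p fun e he => ?_
  have heT := p.edges_subset_edgeSet he
  have hnr := not_reachable_deleteEdges_of_mem_edges hT.isAcyclic hp he
  have hweight := totalWeight_exchange w heT hnr
  have htree : (T.deleteEdges {e} ⊔ edge x y).IsTree := by
    induction e using Sym2.ind with
    | _ a b => exact isTree_exchange hT hnr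
  have hle := hmin _ ⟨sup_le ((deleteEdges_le _).trans hTG) ((edge_le_iff ..).2 (.inr hxy)), htree⟩
  lia

theorem IsSpanningTree.exists_exchange {G T T' : SimpleGraph (Fin n)} {w : Sym2 (Fin n) → ℤ}
    (hTG : T ≤ G) (h : ∀ x y, G.Adj x y → (below T w (w s(x, y))).Reachable x y)
    (hT' : IsSpanningTree G T') (hnot : ¬ T' ≤ T) :
    ∃ T'', IsSpanningTree G T'' ∧ totalWeight w T'' ≤ totalWeight w T' ∧
      T''.edgeSet \ T.edgeSet ⊂ T'.edgeSet \ T.edgeSet := by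
  obtain ⟨e, he, heT⟩ := Set.not_subset.1 (mt edgeSet_subset_edgeSet.1 hnot)
  induction e using Sym2.ind with
  | _ x y =>
  have hbridge : ¬ (T'.deleteEdges {s(x, y)}).Reachable x y :=
    isBridge_iff.1 (isAcyclic_iff_forall_isBridge.1 hT'.2.isAcyclic he)
  obtain ⟨p⟩ := h x y (hT'.1 he)
  obtain ⟨⟨⟨u, v⟩, huv⟩, -, hxu, hxv⟩ := p.exists_boundary_dart
    {z | (T'.deleteEdges {s(x, y)}).Reachable x z} .rfl hbridge
  have hnr : ¬ (T'.deleteEdges {s(x, y)}).Reachable u v := fun hr => hxv (hxu.trans hr)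
  refine ⟨_, ⟨sup_le ((deleteEdges_le _).trans hT'.1)
    ((edge_le_iff ..).2 (.inr (hTG huv.1))), isTree_exchange hT'.2 hnr⟩, ?_, ?_⟩
  · have hweight := totalWeight_exchange w he hnr
    have hle : w s(u, v) ≤ w s(x, y) := huv.2
    lia
  · rw [edgeSet_exchange huv.ne, Set.insert_sdiff_of_mem _ (show s(u, v) ∈ T.edgeSet from huv.1),
      sdiff_right_comm]
    exact Set.sdiff_singleton_ssubset.2 ⟨he, heT⟩

theorem isMST_of_reachable_below {G T : SimpleGraph (Fin n)} {w : Sym2 (Fin n) → ℤ}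
    (hT : IsSpanningTree G T)
    (h : ∀ x y, G.Adj x y → (below T w (w s(x, y))).Reachable x y) : IsMST G w T := by
  refine ⟨hT, fun T' hT' => ?_⟩
  induction hm : (T'.edgeSet \ T.edgeSet).ncard using Nat.strong_induction_on generalizing T' with
  | _ m ih =>
  by_cases hle : T' ≤ T
  · rw [hle.antisymm ((isTree_iff_minimal_connected.1 hT.2).2 hT'.2.connected hle)]
  · obtain ⟨T'', hT'', hweight, hss⟩ := hT'.exists_exchange hT.1 h hle
    exact (ih _ (hm ▸ Set.ncard_lt_ncard hss) T'' hT'' rfl).trans hweight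

end MinimumSpanningTrees

theorem isTree_of_unique_parent {V : Type*} [Finite V] {T : SimpleGraph V} (hT : T.Connected)
    {P : V → V → Prop} (horient : ∀ u v, T.Adj u v → P u v ∨ P v u)
    (hunique : ∀ u v v', P u v → P u v' → v = v') {r : V} (hr : ∀ v, ¬ P r v) : T.IsTree := by
  have hedge : ∀ e ∈ T.edgeSet, ∃ u v, P u v ∧ e = s(u, v) := by
    intro e he
    induction e using Sym2.ind with
    | _ u v => exact (horient u v he).elim (⟨u, v, ·, rfl⟩) (⟨v, u, ·, Sym2.eq_swap⟩)
  have := hT.nonempty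
  choose! child parent hP he using hedge
  have hmaps : Set.MapsTo child T.edgeSet {r}ᶜ := fun e h hc =>
    hr (parent e) (Set.mem_singleton_iff.1 hc ▸ hP e h)
  have hinj : Set.InjOn child T.edgeSet := fun e h e' h' hc => by
    rw [he e h, he e' h', hc, hunique (child e') (parent e) _ (hc ▸ hP e h) (hP e' h')]
  have hcard : T.edgeSet.ncard ≤ ({r}ᶜ : Set V).ncard :=
    Set.ncard_le_ncard_of_injOn child hmaps hinj
  have hcompl := Set.ncard_add_ncard_compl ({r} : Set V)
  rw [Set.ncard_singleton] at hcompl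
  have hle := hT.card_vert_le_card_edgeSet_add_one
  have hncard := Nat.card_coe_set_eq T.edgeSet
  exact isTree_iff_connected_and_card.2 ⟨hT, by lia⟩

section Representatives

variable {V X Y : Type*}

/-- The number of `j < J` at which the sequence `g` changes between `j` and `j + 1`. -/
noncomputable def numChanges (g : ℕ → X) (J : ℕ) : ℕ :=
  open Classical in Nat.count (fun j => g (j + 1) ≠ g j) J

theorem numChanges_zero (g : ℕ → X) : numChanges g 0 = 0 := by simp [numChanges]

theorem numChanges_succ_of_eq {g : ℕ → X} {J : ℕ} (h : g (J + 1) = g J) :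
    numChanges g (J + 1) = numChanges g J := by
  simp [numChanges, Nat.count_succ, h]

theorem numChanges_succ_of_ne {g : ℕ → X} {J : ℕ} (h : g (J + 1) ≠ g J) :
    numChanges g (J + 1) = numChanges g J + 1 := by
  simp [numChanges, Nat.count_succ, h]

theorem numChanges_comp_le (φ : X → Y) (g : ℕ → X) (J : ℕ) :
    numChanges (fun j => φ (g j)) J ≤ numChanges g J := by
  classical exact Nat.count_mono_left fun _ _ h hg => h (congrArg φ hg)

/-- `f` sends every element to a representative of its equivalence class, the same one for the
whole class. -/
structure IsRepresentativeMap (E : Setoid V) (f : V → V) : Prop where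
  rel (v : V) : E v (f v)
  eq_of_rel {u v : V} (h : E u v) : f u = f v

theorem isRepresentativeMap_out (E : Setoid V) :
    IsRepresentativeMap E fun v => (Quotient.mk E v).out where
  rel _ := E.symm (Quotient.exact (Quotient.out_eq _))
  eq_of_rel h := congrArg Quotient.out (Quotient.sound h)

/-- The size of the equivalence class of `v`. -/
noncomputable def classSize (E : Setoid V) (v : V) : ℕ := {u | E v u}.ncard

variable [Finite V]

theorem classSize_pos (E : Setoid V) (v : V) : 0 < classSize E v :=
  (Set.ncard_pos).2 ⟨v, E.refl v⟩

theorem classSize_le_card (E : Setoid V) (v : V) : classSize E v ≤ Nat.card V :=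
  Set.ncard_le_card _

theorem classSize_mono {E E' : Setoid V} (hE : E ≤ E') (v : V) : classSize E v ≤ classSize E' v :=
  Set.ncard_le_ncard fun _ h => hE h

theorem classSize_add_classSize_le {E E' : Setoid V} (hE : E ≤ E') {u v : V} (h' : E' u v)
    (h : ¬ E u v) : classSize E u + classSize E v ≤ classSize E' u := by
  have hdisj : Disjoint {z | E u z} {z | E v z} :=
    Set.disjoint_left.2 fun _ hu hv => h (E.trans hu (E.symm hv))
  rw [classSize, classSize, ← Set.ncard_union_eq hdisj]
  exact Set.ncard_le_ncard (Set.union_subset (fun _ hz => hE hz) fun _ hz => E'.trans h' (hE hz))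

theorem IsRepresentativeMap.exists_of_le {E E' : Setoid V} (hE : E ≤ E') {f : V → V}
    (hf : IsRepresentativeMap E f) :
    ∃ f', IsRepresentativeMap E' f' ∧ ∀ v, f' v ≠ f v → 2 * classSize E v ≤ classSize E' v := by
  have hlargest (q : Quotient E') : ∃ x, Quotient.mk E' x = q ∧
      ∀ y, Quotient.mk E' y = q → classSize E y ≤ classSize E x :=
    Set.exists_max_image {x | Quotient.mk E' x = q} (classSize E) (Set.toFinite _)
      (Quotient.exists_rep q)
  choose m hm hmax using hlargest
  have hrel (v : V) : E' v (m (Quotient.mk E' v)) := E'.symm (Quotient.exact (hm _))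
  refine ⟨fun v => f (m (Quotient.mk E' v)), ⟨fun v => E'.trans (hrel v) (hE (hf.rel _)),
    fun h => congrArg (f ∘ m) (Quotient.sound h)⟩, fun v hne => ?_⟩
  have hnot : ¬ E v (m (Quotient.mk E' v)) := fun h => hne (hf.eq_of_rel h).symm
  have hadd := classSize_add_classSize_le hE (hrel v) hnot
  have hle := hmax _ v rfl
  lia

-- The representative of a merged class is that of its largest part: smaller-to-larger.
theorem exists_isRepresentativeMap_two_pow_numChanges_le {E : ℕ → Setoid V} (hE : Monotone E) :
    ∃ f : ℕ → V → V, (∀ j, IsRepresentativeMap (E j) (f j)) ∧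
      ∀ J v, 2 ^ numChanges (f · v) J ≤ Nat.card V := by
  choose next hnext hdouble using fun j (f : {f // IsRepresentativeMap (E j) f}) =>
    f.2.exists_of_le (hE j.le_succ)
  let F (j : ℕ) : {f // IsRepresentativeMap (E j) f} :=
    j.rec ⟨_, isRepresentativeMap_out (E 0)⟩ fun j f => ⟨next j f, hnext j f⟩
  refine ⟨fun j => (F j).1, fun j => (F j).2, fun J v => le_trans ?_ (classSize_le_card (E J) v)⟩
  induction J with
  | zero => exact (numChanges_zero _).symm ▸ classSize_pos (E 0) v
  | succ J ih =>
    by_cases h : (F (J + 1)).1 v = (F J).1 v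
    · rw [numChanges_succ_of_eq h]
      exact ih.trans (classSize_mono (hE J.le_succ) v)
    · rw [numChanges_succ_of_ne h, pow_succ']
      exact (Nat.mul_le_mul_left 2 ih).trans (hdouble J (F J) v h)

end Representatives

section PortalInfo

variable {X : Type*} {M : ℕ}

/-- The step function described by a list of records `(p, y)`, meaning that it takes the value `y`
from position `p` on; the latest position comes first, and `x` is the value before all records. -/
def evalRecords (x : X) : List (Fin M × X) → ℕ → X
  | [], _ => x
  | r :: l, j => if r.1 ≤ j then r.2 else evalRecords x l j

theorem exists_evalRecords_eq (g : ℕ → X) {J L : ℕ} (h : numChanges g J ≤ L) (hJ : J < M) :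
    ∃ l : List.Vector (Fin M × X) L, ∀ j, evalRecords (g 0) l.toList j = g (min j J) := by
  induction J generalizing L with
  | zero =>
    refine ⟨.replicate L (⟨0, hJ⟩, g 0), fun j => ?_⟩
    cases L <;> simp [List.Vector.replicate, List.Vector.toList, List.replicate_succ, evalRecords]
  | succ J ih =>
    by_cases heq : g (J + 1) = g J
    · obtain ⟨l, hl⟩ := ih (numChanges_succ_of_eq heq ▸ h) (by lia)
      refine ⟨l, fun j => ?_⟩
      rcases le_or_gt j J with hj | hj
      · rw [hl, min_eq_left hj, min_eq_left (by lia)]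
      · rw [hl, min_eq_right hj.le, min_eq_right hj, heq]
    · rw [numChanges_succ_of_ne heq] at h
      obtain ⟨L, rfl⟩ := Nat.exists_eq_add_of_lt (Nat.zero_lt_of_lt h)
      obtain ⟨l, hl⟩ := ih (L := 0 + L) (by lia) (by lia)
      refine ⟨(⟨J + 1, hJ⟩, g (J + 1)) ::ᵥ l, fun j => ?_⟩
      rcases le_or_gt j J with hj | hj
      · simp [evalRecords, hl, hj, hj.trans J.le_succ]
      · simp [evalRecords, hj]

/-- What a portal knows: its depth in the marked tree and, for every weight `β`, the identifier of
the representative of its fragment in `T_{≤ β}` together with the distance to that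
representative. -/
structure PortalInfo (a n : ℕ) where
  depth : Fin n
  level : ℤ → Fin a × Fin n

/-- `dec` can produce all portal information on weights of absolute value at most `N` that changes
at most `L` times as the weight increases. -/
def IsPortalDecoder {a n : ℕ} {B : Type*} (N L : ℕ) (dec : B → PortalInfo a n) : Prop :=
  ∀ (D : Fin n) (g : ℤ → Fin a × Fin n), numChanges (fun j : ℕ => g (j - N : ℤ)) (2 * N) ≤ L →
    ∃ B, (dec B).depth = D ∧ ∀ β : ℤ, |β| ≤ N → (dec B).level β = g β

theorem exists_isPortalDecoder {a n N L : ℕ} [NeZero a] [NeZero n] {B : Type*} [Fintype B]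
    (hB : n * (a * n) * ((2 * N + 1) * (a * n)) ^ L ≤ Fintype.card B) :
    ∃ dec : B → PortalInfo a n, IsPortalDecoder N L dec := by
  let R := (Fin n × (Fin a × Fin n)) × List.Vector (Fin (2 * N + 1) × (Fin a × Fin n)) L
  have hR : Fintype.card R = n * (a * n) * ((2 * N + 1) * (a * n)) ^ L := by
    simp [R, card_vector]
  have : Nonempty R := ⟨(0, (0, 0)), .replicate L (0, (0, 0))⟩
  obtain ⟨e⟩ := Function.Embedding.nonempty_of_card_le (hR.trans_le hB)
  refine ⟨fun B => let r := Function.invFun e B;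
    ⟨r.1.1, fun β => evalRecords r.1.2 r.2.toList (β + N).toNat⟩, fun D g hg => ?_⟩
  obtain ⟨l, hl⟩ := exists_evalRecords_eq _ hg (Nat.lt_succ_self _)
  obtain ⟨B, hB⟩ := Function.invFun_surjective e.injective ((D, g ((0 : ℕ) - N : ℤ)), l)
  refine ⟨B, by simp only [hB], fun β hβ => ?_⟩
  obtain ⟨hlo, hhi⟩ := abs_le.1 hβ
  simp only [hB, hl]
  congr 1
  lia

end PortalInfo

section Verifier

/-- The content of the label of a node: the color is its depth in the marked tree modulo 3, and
`isStorage` tells that the node stores `bits` on behalf of the portal whose storage path it lies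
on. -/
structure NodeLabel where
  color : ZMod 3
  isPortal : Bool
  isStorage : Bool
  isRoot : Bool
  bits : ℕ → Bool

/-- Reading the content of a label; bits that are missing count as `false`. -/
def NodeLabel.decode (l : List Bool) : NodeLabel where
  color := (l.getD 0 false).toNat + 2 * (l.getD 1 false).toNat
  isPortal := l.getD 2 false
  isStorage := l.getD 3 false
  isRoot := l.getD 4 false
  bits i := l.getD (i + 5) false

theorem NodeLabel.exists_decode_eq (x : NodeLabel) (b : ℕ) :
    ∃ l : List Bool, l.length = b + 5 ∧ (decode l).color = x.color ∧
      (decode l).isPortal = x.isPortal ∧ (decode l).isStorage = x.isStorage ∧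
      (decode l).isRoot = x.isRoot ∧ ∀ i < b, (decode l).bits i = x.bits i := by
  have hcolor : ∀ c : ZMod 3, ∃ p q : Bool, (p.toNat : ZMod 3) + 2 * (q.toNat : ZMod 3) = c := by
    decide
  obtain ⟨p, q, hpq⟩ := hcolor x.color
  refine ⟨p :: q :: x.isPortal :: x.isStorage :: x.isRoot :: (List.range b).map x.bits,
    by simp, hpq, rfl, rfl, rfl, fun i hi => ?_⟩
  simp [decode, hi]

/-- A node as it appears in a view: its identifier, its input and its label. -/
abbrev ViewNode : Type := ℕ × MSTInput × List Bool

/-- The content of the label of a node in a view. -/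
def ViewNode.label (x : ViewNode) : NodeLabel := .decode x.2.2

/-- `y` is joined to `x` by a marked edge of weight at most `β`. -/
def MarkedStep (β : ℤ) (x y : ViewNode) : Prop := ∃ w ≤ β, (y.1, w, true) ∈ x.2.1

/-- `y` is reached from `x` by marked edges of weight at most `β` inside `A`. -/
def ReachIn (A : Set ViewNode) (β : ℤ) : ViewNode → ViewNode → Prop :=
  Relation.ReflTransGen fun x y => y ∈ A ∧ MarkedStep β x y

/-- According to the colors, `y` is the parent of `x` in the marked tree. -/
def ParentStep (x y : ViewNode) : Prop :=
  (∃ β, MarkedStep β x y) ∧ y.label.color = x.label.color - 1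

/-- `y` is a child of `x` that continues the storage path through `x`. -/
def StorageStep (x y : ViewNode) : Prop :=
  (∃ β, MarkedStep β x y) ∧ y.label.isStorage = true ∧ y.label.color = x.label.color + 1

variable {a n s b : ℕ}

/-- The portal `x` stores `P`, spread over a path of `s` nodes of `A` that starts at `x`. -/
def Stored (A : Set ViewNode) (dec : (Fin s → Fin b → Bool) → PortalInfo a n)
    (x : ViewNode) (P : PortalInfo a n) : Prop :=
  x.label.isPortal = true ∧ ∃ g : ℕ → ViewNode, g 0 = x ∧ (∀ i < s, g i ∈ A) ∧
    (∀ i, i + 1 < s → StorageStep (g i) (g (i + 1))) ∧ dec (fun i j => (g i).label.bits j) = P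

/-- From `x` one reaches, by marked edges of weight at most `β` inside `A`, a portal that
stores `P`. -/
def SeesPortal (A : Set ViewNode) (dec : (Fin s → Fin b → Bool) → PortalInfo a n) (β : ℤ)
    (x : ViewNode) (P : PortalInfo a n) : Prop :=
  ∃ y, ReachIn A β x y ∧ Stored A dec y P

/-- `A` contains the root or a portal of depth less than `D`, which leads further to the root. -/
def SeesRoot (A : Set ViewNode) (dec : (Fin s → Fin b → Bool) → PortalInfo a n) (D : ℕ) : Prop :=
  ∃ y ∈ A, y.label.isRoot = true ∨ ∃ P, Stored A dec y P ∧ P.depth < D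

/-- The local check of the node `x` that sees the nodes `A`, when weights have absolute value at
most `N`. -/
structure Accepts (N : ℕ) (dec : (Fin s → Fin b → Bool) → PortalInfo a n) (A : Set ViewNode)
    (x : ViewNode) : Prop where
  color_ne : ∀ y ∈ A, ∀ β, MarkedStep β x y → y.label.color ≠ x.label.color
  not_parentStep : x.label.isRoot = true → ∀ y ∈ A, ¬ ParentStep x y
  parentStep_unique : ∀ y ∈ A, ∀ z ∈ A, ParentStep x y → ParentStep x z → y = z
  storageStep_unique : ∀ y ∈ A, ∀ z ∈ A, StorageStep x y → StorageStep x z → y = z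
  edge : ∀ y ∈ A, ∀ β m, (y.1, β, m) ∈ x.2.1 → ReachIn A β x y ∨
    ∃ P Q, SeesPortal A dec β x P ∧ SeesPortal A dec β y Q ∧ (P.level β).1 = (Q.level β).1
  seesRoot : SeesRoot A dec n
  portal : x.label.isPortal = true → ∃ P, Stored A dec x P ∧ SeesRoot A dec P.depth ∧
    ∀ β : ℤ, |β| ≤ N → x.1 = (P.level β).1 ∨ ∃ Q, SeesPortal A dec β x Q ∧
      (Q.level β).1 = (P.level β).1 ∧ (Q.level β).2 < (P.level β).2

variable {A B : Set ViewNode} {dec : (Fin s → Fin b → Bool) → PortalInfo a n} {x : ViewNode}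
  {P Q : PortalInfo a n}

theorem Stored.mono (hAB : A ⊆ B) (h : Stored A dec x P) : Stored B dec x P := by
  obtain ⟨hx, g, hg, hA, hpath⟩ := h
  exact ⟨hx, g, hg, fun i hi => hAB (hA i hi), hpath⟩

theorem Stored.unique
    (hA : ∀ x ∈ A, ∀ y ∈ A, ∀ z ∈ A, StorageStep x y → StorageStep x z → y = z)
    (hP : Stored A dec x P) (hQ : Stored A dec x Q) : P = Q := by
  obtain ⟨-, g, hg0, hgA, hg, rfl⟩ := hP
  obtain ⟨-, g', hg0', hgA', hg', rfl⟩ := hQ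
  have hpath : ∀ i < s, g i = g' i := by
    intro i hi
    induction i with
    | zero => rw [hg0, hg0']
    | succ i ih =>
      have heq := ih (by lia)
      exact hA _ (hgA i (by lia)) _ (hgA _ hi) _ (hgA' _ hi) (hg i hi) (heq ▸ hg' i hi)
  congr 1
  funext i j
  rw [hpath i i.2]

end Verifier

section Views

variable {d k n r : ℕ} {c : Config MSTInput k n} {w : Sym2 (Fin n) → ℤ} {T : SimpleGraph (Fin n)}
  {l : Fin n → List Bool} {u v : Fin n}

/-- The node `u` as it appears in the views that contain it. -/
def Config.viewNode (c : Config MSTInput k n) (l : Fin n → List Bool) (u : Fin n) : ViewNode :=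
  (c.id u, c.input u, l u)

theorem Config.viewNode_injective (c : Config MSTInput k n) (l : Fin n → List Bool) :
    Function.Injective (c.viewNode l) :=
  fun _ _ h => c.id_injective (congrArg Prod.fst h)

theorem Config.viewNode_mem_nodes (h : c.graph.dist v u ≤ r) :
    c.viewNode l u ∈ (c.view l r v).nodes :=
  ⟨u, h, rfl⟩

theorem Config.viewNode_mem_nodes_of_adj (hr : 1 ≤ r) (h : c.graph.Adj v u) :
    c.viewNode l u ∈ (c.view l r v).nodes :=
  viewNode_mem_nodes ((dist_eq_one_iff_adj.2 h).trans_le hr)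

theorem Config.nodes_subset_range (c : Config MSTInput k n) (l : Fin n → List Bool) (r : ℕ)
    (v : Fin n) : (c.view l r v).nodes ⊆ Set.range (c.viewNode l) := by
  rintro _ ⟨u, -, rfl⟩
  exact ⟨u, rfl⟩

theorem Encodes.mem_input_iff (h : Encodes d c w T) {β : ℤ} {m : Bool} :
    (c.id v, β, m) ∈ c.input u ↔ c.graph.Adj u v ∧ w s(u, v) = β ∧ (m = true ↔ T.Adj u v) := by
  classical
  simp only [h.2.2 u, mstInput, Finset.mem_image, mem_neighborFinset, Prod.mk.injEq]
  constructor
  · rintro ⟨v', hadj, hid, rfl, rfl⟩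
    obtain rfl := c.id_injective hid
    exact ⟨hadj, rfl, decide_eq_true_iff⟩
  · rintro ⟨hadj, rfl, hm⟩
    exact ⟨v, hadj, rfl, rfl, Bool.eq_iff_iff.2 (decide_eq_true_iff.trans hm.symm)⟩

theorem Encodes.markedStep_iff (h : Encodes d c w T) {β : ℤ} :
    MarkedStep β (c.viewNode l u) (c.viewNode l v) ↔ (below T w β).Adj u v := by
  constructor
  · rintro ⟨_, hβ, hm⟩
    obtain ⟨-, rfl, hT⟩ := h.mem_input_iff.1 hm
    exact ⟨hT.1 rfl, hβ⟩
  · rintro ⟨hT, hβ⟩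
    exact ⟨_, hβ, h.mem_input_iff.2 ⟨h.2.1 hT, rfl, iff_of_true rfl hT⟩⟩

theorem Encodes.exists_markedStep_iff (h : Encodes d c w T) :
    (∃ β, MarkedStep β (c.viewNode l u) (c.viewNode l v)) ↔ T.Adj u v := by
  simp only [h.markedStep_iff]
  exact ⟨fun ⟨_, hadj⟩ => hadj.1, fun hadj => ⟨_, hadj, le_rfl⟩⟩

theorem Encodes.reachable_of_reachIn (h : Encodes d c w T) {β : ℤ} {y : ViewNode}
    (hy : ReachIn (c.view l r v).nodes β (c.viewNode l u) y) :
    ∃ z, c.viewNode l z = y ∧ (below T w β).Reachable u z := by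
  induction hy with
  | refl => exact ⟨u, rfl, .rfl⟩
  | tail _ hstep ih =>
    obtain ⟨z, rfl, hz⟩ := ih
    obtain ⟨z', -, rfl⟩ := hstep.1
    exact ⟨z', rfl, hz.trans (h.markedStep_iff.1 hstep.2).reachable⟩

end Views

section Soundness

variable {d k n N a s b r : ℕ} {c : Config MSTInput k n} {w : Sym2 (Fin n) → ℤ}
  {T : SimpleGraph (Fin n)} {dec : (Fin s → Fin b → Bool) → PortalInfo a n}
  {l : Fin n → List Bool}

theorem Encodes.stored_unique (h : Encodes d c w T) (hr : 1 ≤ r)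
    (hacc : ∀ v, Accepts N dec (c.view l r v).nodes (c.viewNode l v)) {x : ViewNode}
    {P Q : PortalInfo a n} (hP : Stored (Set.range (c.viewNode l)) dec x P)
    (hQ : Stored (Set.range (c.viewNode l)) dec x Q) : P = Q := by
  refine hP.unique ?_ hQ
  rintro _ ⟨u, rfl⟩ _ ⟨v, rfl⟩ _ ⟨v', rfl⟩ hv hv'
  exact (hacc u).storageStep_unique _
    (Config.viewNode_mem_nodes_of_adj hr (h.2.1 (h.exists_markedStep_iff.1 hv.1))) _
    (Config.viewNode_mem_nodes_of_adj hr (h.2.1 (h.exists_markedStep_iff.1 hv'.1))) hv hv'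

-- Representatives are certified by pointers along which the stored distance decreases.
theorem Encodes.exists_reachable_representative (h : Encodes d c w T) (hr : 1 ≤ r)
    (hacc : ∀ v, Accepts N dec (c.view l r v).nodes (c.viewNode l v)) {β : ℤ} (hβ : |β| ≤ N)
    {u : Fin n} {P : PortalInfo a n}
    (hP : Stored (Set.range (c.viewNode l)) dec (c.viewNode l u) P) :
    ∃ v, c.id v = (P.level β).1 ∧ (below T w β).Reachable u v := by
  induction hδ : (P.level β).2 using WellFoundedLT.induction generalizing u P with
  | _ δ ih =>
  obtain ⟨P', hP', -, hlevel⟩ := (hacc u).portal hP.1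
  obtain rfl := h.stored_unique hr hacc (hP'.mono (c.nodes_subset_range l r u)) hP
  obtain hid | ⟨Q, ⟨y, hy, hQ⟩, hid, hlt⟩ := hlevel β hβ
  · exact ⟨u, hid, .rfl⟩
  · obtain ⟨v, rfl, huv⟩ := h.reachable_of_reachIn hy
    obtain ⟨z, hz, hvz⟩ := ih _ (hδ ▸ hlt) (hQ.mono (c.nodes_subset_range l r u)) rfl
    exact ⟨z, hz.trans (congrArg Fin.val hid), huv.trans hvz⟩

theorem Encodes.reachable_of_seesPortal (h : Encodes d c w T) (hr : 1 ≤ r)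
    (hacc : ∀ v, Accepts N dec (c.view l r v).nodes (c.viewNode l v)) {β : ℤ} (hβ : |β| ≤ N)
    {u v x : Fin n} {P Q : PortalInfo a n}
    (hP : SeesPortal (c.view l r x).nodes dec β (c.viewNode l u) P)
    (hQ : SeesPortal (c.view l r x).nodes dec β (c.viewNode l v) Q)
    (hPQ : (P.level β).1 = (Q.level β).1) : (below T w β).Reachable u v := by
  obtain ⟨_, hp, hP⟩ := hP
  obtain ⟨_, hq, hQ⟩ := hQ
  obtain ⟨p, rfl, hup⟩ := h.reachable_of_reachIn hp
  obtain ⟨q, rfl, hvq⟩ := h.reachable_of_reachIn hq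
  have hsub := c.nodes_subset_range l r x
  obtain ⟨z, hz, hpz⟩ := h.exists_reachable_representative hr hacc hβ (hP.mono hsub)
  obtain ⟨z', hz', hqz⟩ := h.exists_reachable_representative hr hacc hβ (hQ.mono hsub)
  obtain rfl : z = z' := c.id_injective (by rw [hz, hz', hPQ])
  exact (hup.trans hpz).trans (hvq.trans hqz).symm

theorem Encodes.reachable_below_of_accepts (h : Encodes d c w T) (hr : 1 ≤ r)
    (hacc : ∀ v, Accepts (n ^ d) dec (c.view l r v).nodes (c.viewNode l v)) {x y : Fin n}
    (hxy : c.graph.Adj x y) : (below T w (w s(x, y))).Reachable x y := by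
  classical
  obtain hreach | ⟨P, Q, hP, hQ, hPQ⟩ := (hacc x).edge _
    (Config.viewNode_mem_nodes_of_adj hr hxy) (w s(x, y)) (decide (T.Adj x y))
    (h.mem_input_iff.2 ⟨hxy, rfl, decide_eq_true_iff⟩)
  · obtain ⟨z, hz, hxz⟩ := h.reachable_of_reachIn hreach
    exact c.viewNode_injective l hz ▸ hxz
  · exact h.reachable_of_seesPortal hr hacc (mod_cast h.1 _ hxy) hP hQ hPQ

-- Whoever does not see the root sees a portal of smaller depth.
theorem Encodes.exists_root (h : Encodes d c w T) (hr : 1 ≤ r)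
    (hacc : ∀ v, Accepts N dec (c.view l r v).nodes (c.viewNode l v)) :
    ∃ u, (c.viewNode l u).label.isRoot = true := by
  have hdescend (D : ℕ) (x : Fin n) (hD : SeesRoot (c.view l r x).nodes dec D) :
      ∃ u, (c.viewNode l u).label.isRoot = true := by
    induction D using Nat.strong_induction_on generalizing x with
    | _ D ih =>
    obtain ⟨_, ⟨u, -, rfl⟩, hu | ⟨P, hP, hlt⟩⟩ := hD
    · exact ⟨u, hu⟩
    · obtain ⟨P', hP', hroot, -⟩ := (hacc u).portal hP.1
      obtain rfl := h.stored_unique hr hacc (hP'.mono (c.nodes_subset_range l r u))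
        (hP.mono (c.nodes_subset_range l r x))
      exact ih _ hlt u hroot
  obtain ⟨x⟩ := c.connected.nonempty
  exact hdescend n x (hacc x).seesRoot

theorem Encodes.isTree_of_accepts (h : Encodes d c w T) (hr : 1 ≤ r) (hT : T.Connected)
    (hacc : ∀ v, Accepts N dec (c.view l r v).nodes (c.viewNode l v)) : T.IsTree := by
  obtain ⟨u, hu⟩ := h.exists_root hr hacc
  have hmem {x y : Fin n} (hxy : T.Adj x y) : c.viewNode l y ∈ (c.view l r x).nodes :=
    Config.viewNode_mem_nodes_of_adj hr (h.2.1 hxy)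
  have horient : ∀ p q : ZMod 3, q ≠ p → q = p - 1 ∨ p = q - 1 := by decide
  refine isTree_of_unique_parent hT (r := u)
    (P := fun x y => ParentStep (c.viewNode l x) (c.viewNode l y))
    (fun x y hxy => ?_) (fun x y z hy hz => ?_)
    fun y hy => (hacc u).not_parentStep hu _ (hmem (h.exists_markedStep_iff.1 hy.1)) hy
  · have hne := (hacc x).color_ne _ (hmem hxy) _ (h.markedStep_iff.2 ⟨hxy, le_rfl⟩)
    exact (horient _ _ hne).imp (⟨h.exists_markedStep_iff.2 hxy, ·⟩)
      (⟨h.exists_markedStep_iff.2 hxy.symm, ·⟩)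
  · exact c.viewNode_injective l ((hacc x).parentStep_unique _
      (hmem (h.exists_markedStep_iff.1 hy.1)) _ (hmem (h.exists_markedStep_iff.1 hz.1)) hy hz)

theorem Encodes.isMST_of_accepts (h : Encodes d c w T) (hr : 1 ≤ r)
    (hacc : ∀ v, Accepts (n ^ d) dec (c.view l r v).nodes (c.viewNode l v)) :
    IsMST c.graph w T := by
  have hedge (x y : Fin n) (hxy : c.graph.Adj x y) := h.reachable_below_of_accepts hr hacc hxy
  have := c.connected.nonempty
  have hT : T.Connected := ⟨fun u v => by
    obtain ⟨p⟩ := c.connected u v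
    induction p with
    | nil => exact .rfl
    | cons hadj _ ih => exact ((hedge _ _ hadj).mono (below_le _ _ _)).trans ih⟩
  exact isMST_of_reachable_below ⟨h.2.1, h.isTree_of_accepts hr hT hacc⟩ hedge

end Soundness

section RootedTrees

variable {V : Type*} {T : SimpleGraph V}

theorem length_eq_dist_of_isPath (hT : T.IsTree) {u v : V} {p : T.Walk u v} (hp : p.IsPath) :
    p.length = T.dist u v := by
  obtain ⟨q, hq, hlen⟩ := hT.connected.exists_path_of_dist u v
  have hpq : p = q :=
    congrArg Subtype.val ((hT.isAcyclic.subsingleton_path u v).elim ⟨p, hp⟩ ⟨q, hq⟩)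
  rw [hpq, hlen]

theorem exists_adj_dist_add_one_eq (hT : T.Connected) {r x : V} (hx : T.dist r x ≠ 0) :
    ∃ y, T.Adj x y ∧ T.dist r y + 1 = T.dist r x := by
  obtain ⟨p, hlen⟩ := hT.exists_walk_length_eq_dist r x
  have hadj := p.adj_penultimate fun hnil => hx (hlen ▸ hnil.length_eq_zero)
  have hle := T.dist_le p.dropLast
  have hlt := hT.dist_triangle (u := r) (v := p.penultimate) (w := x)
  rw [Walk.length_dropLast] at hle
  rw [dist_eq_one_iff_adj.2 hadj] at hlt
  exact ⟨_, hadj.symm, by lia⟩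

theorem eq_of_adj_of_dist_add_one_eq (hT : T.IsTree) {r x y z : V} (hy : T.Adj x y)
    (hyr : T.dist r y + 1 = T.dist r x) (hz : T.Adj x z) (hzr : T.dist r z + 1 = T.dist r x) :
    y = z := by
  obtain ⟨p, hp⟩ := hT.connected.exists_walk_length_eq_dist r y
  obtain ⟨q, hq⟩ := hT.connected.exists_walk_length_eq_dist r z
  have hpath := (p.concat hy.symm).isPath_of_length_eq_dist (by rw [Walk.length_concat, hp, hyr])
  have hpath' := (q.concat hz.symm).isPath_of_length_eq_dist (by rw [Walk.length_concat, hq, hzr])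
  have heq : p.concat hy.symm = q.concat hz.symm :=
    congrArg Subtype.val ((hT.isAcyclic.subsingleton_path r x).elim ⟨_, hpath⟩ ⟨_, hpath'⟩)
  simpa only [Walk.penultimate_concat] using congrArg Walk.penultimate heq

/-- A rooting of `T` assigns depths to the nodes, and a parent to every node of positive depth
(elsewhere `par` is arbitrary), so that every edge joins a node to its parent. -/
structure Rooting (T : SimpleGraph V) where
  dep : V → ℕ
  par : V → V
  adj_par : ∀ x, dep x ≠ 0 → T.Adj x (par x)
  dep_par : ∀ x, dep x ≠ 0 → dep (par x) + 1 = dep x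
  dep_of_adj : ∀ x y, T.Adj x y → dep y + 1 = dep x ∨ dep x + 1 = dep y
  par_eq : ∀ x y, T.Adj x y → dep y + 1 = dep x → par x = y

theorem exists_rooting (hT : T.IsTree) (r : V) :
    ∃ R : Rooting T, ∀ x, R.dep x = T.dist r x := by
  have : Nonempty V := ⟨r⟩
  choose! par hadj hdist using fun x (hx : T.dist r x ≠ 0) =>
    exists_adj_dist_add_one_eq hT.connected hx
  exact ⟨⟨T.dist r, par, hadj, hdist,
    fun x y h => (hT.dist_eq_dist_add_one_of_adj r h).imp Eq.symm Eq.symm,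
    fun x y h hxy => eq_of_adj_of_dist_add_one_eq hT (hadj x (by lia)) (hdist x (by lia)) h hxy⟩,
    fun _ => rfl⟩

namespace Rooting

variable {R : Rooting T} {s : ℕ} {x y : V}

theorem dep_iterate {i : ℕ} (hi : i ≤ R.dep x) : R.dep (R.par^[i] x) + i = R.dep x := by
  induction i with
  | zero => rfl
  | succ i ih =>
    have hdep := ih (by lia)
    have hpar := R.dep_par (R.par^[i] x) (by lia)
    rw [Function.iterate_succ_apply']
    lia

variable (R s x) in
/-- A portal for the spacing `s`: its depth is divisible by `s`, and it has a descendant `s - 1`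
levels below, so that it starts a path of `s` nodes of its own. -/
def IsPortal : Prop :=
  s ∣ R.dep x ∧ ∃ y, R.dep y = R.dep x + (s - 1) ∧ R.par^[s - 1] y = x

theorem exists_isPortal_iterate (hs : 0 < s) (hy : 2 * (s - 1) ≤ R.dep y) :
    ∃ i ≤ 2 * (s - 1), R.IsPortal s (R.par^[i] y) := by
  set i := (R.dep y - (s - 1)) % s
  have hi : i < s := Nat.mod_lt _ hs
  have htop := R.dep_iterate (x := y) (i := s - 1 + i) (by lia)
  have hbottom := R.dep_iterate (x := y) (i := i) (by lia)
  refine ⟨s - 1 + i, by lia, ?_, R.par^[i] y, by lia, (Function.iterate_add_apply ..).symm⟩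
  rw [show R.dep (R.par^[s - 1 + i] y) = R.dep y - (s - 1) - i by lia]
  exact Nat.dvd_sub_mod _

theorem exists_isPortal_of_ascending (hs : 0 < s) {f : ℕ → V}
    (hadj : ∀ i < 2 * (s - 1), T.Adj (f i) (f (i + 1)))
    (hdep : ∀ i < 2 * (s - 1), R.dep (f (i + 1)) + 1 = R.dep (f i)) :
    ∃ i ≤ 2 * (s - 1), R.IsPortal s (f i) := by
  have hiter (i : ℕ) (hi : i ≤ 2 * (s - 1)) :
      R.par^[i] (f 0) = f i ∧ R.dep (f i) + i = R.dep (f 0) := by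
    induction i with
    | zero => exact ⟨rfl, rfl⟩
    | succ i ih =>
      obtain ⟨hpar, hsum⟩ := ih (by lia)
      have hstep := hdep i hi
      rw [Function.iterate_succ_apply', hpar]
      exact ⟨R.par_eq _ _ (hadj i hi) hstep, by lia⟩
  obtain ⟨i, hi, hportal⟩ := R.exists_isPortal_iterate hs ((hiter _ le_rfl).2 ▸ Nat.le_add_left _ _)
  exact ⟨i, hi, (hiter i hi).1 ▸ hportal⟩

theorem dep_succ_of_dep_succ {z : V} (hxy : T.Adj x y) (hyz : T.Adj y z) (hne : x ≠ z)
    (h : R.dep x + 1 = R.dep y) : R.dep y + 1 = R.dep z :=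
  (R.dep_of_adj y z hyz).resolve_left fun hz =>
    hne ((R.par_eq y x hxy.symm h).symm.trans (R.par_eq y z hyz hz))

-- A walk without immediate return cannot go up again once it has gone down.
theorem exists_isPortal_of_chain (hs : 0 < s) {g : ℕ → V}
    (hadj : ∀ i < 4 * (s - 1), T.Adj (g i) (g (i + 1)))
    (hne : ∀ i, i + 1 < 4 * (s - 1) → g i ≠ g (i + 2)) :
    ∃ i ≤ 4 * (s - 1), R.IsPortal s (g i) := by
  by_cases hup : ∀ i < 2 * (s - 1), R.dep (g (i + 1)) + 1 = R.dep (g i)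
  · obtain ⟨i, hi, hportal⟩ := R.exists_isPortal_of_ascending hs (fun i hi => hadj i (by lia)) hup
    exact ⟨i, by lia, hportal⟩
  push Not at hup
  obtain ⟨i, hi, hnot⟩ := hup
  have hdown (j : ℕ) (hij : i ≤ j) (hj : j < 4 * (s - 1)) :
      R.dep (g j) + 1 = R.dep (g (j + 1)) := by
    induction j, hij using Nat.le_induction with
    | base => exact (R.dep_of_adj _ _ (hadj i hj)).resolve_left hnot
    | succ j _ ih =>
      exact R.dep_succ_of_dep_succ (hadj j (by lia)) (hadj _ hj) (hne j hj) (ih (by lia))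
  have hsub (j : ℕ) (hj : j < 2 * (s - 1)) : 4 * (s - 1) - (j + 1) + 1 = 4 * (s - 1) - j := by lia
  obtain ⟨j, -, hportal⟩ := R.exists_isPortal_of_ascending (f := fun j => g (4 * (s - 1) - j)) hs
    (fun j hj => hsub j hj ▸ (hadj (4 * (s - 1) - (j + 1)) (by lia)).symm)
    (fun j hj => hsub j hj ▸ hdown (4 * (s - 1) - (j + 1)) (by lia) (by lia))
  exact ⟨_, Nat.sub_le _ _, hportal⟩

variable (R) in
theorem exists_isPortal_of_isPath (hs : 0 < s) {H : SimpleGraph V} (hH : H ≤ T) {u v : V}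
    {p : H.Walk u v} (hp : p.IsPath) {j : ℕ} (hj : j + 4 * (s - 1) ≤ p.length) :
    ∃ i, j ≤ i ∧ i ≤ j + 4 * (s - 1) ∧ R.IsPortal s (p.getVert i) := by
  obtain ⟨i, hi, hportal⟩ := R.exists_isPortal_of_chain hs (g := fun i => p.getVert (j + i))
    (fun i hi => hH (p.adj_getVert_succ (by lia))) fun i hi heq => by
      have := hp.getVert_injOn (show j + i ≤ p.length by lia)
        (show j + (i + 2) ≤ p.length by lia) heq
      lia
  exact ⟨j + i, by lia, by lia, hportal⟩

open Classical in
variable (R s x) in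
/-- The lower end of the storage path of the portal `x`; it is `x` itself if `x` is no portal. -/
noncomputable def tip : V :=
  if h : ∃ y, R.dep y = R.dep x + (s - 1) ∧ R.par^[s - 1] y = x then h.choose else x

variable (R s x) in
/-- The storage path of the portal `x`: it has the `s` nodes `R.storage s x i` with `i < s`. -/
noncomputable def storage (i : ℕ) : V := R.par^[s - 1 - i] (R.tip s x)

theorem IsPortal.tip_spec (h : R.IsPortal s x) :
    R.dep (R.tip s x) = R.dep x + (s - 1) ∧ R.par^[s - 1] (R.tip s x) = x := by
  rw [tip, dif_pos h.2]
  exact h.2.choose_spec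

theorem IsPortal.storage_zero (h : R.IsPortal s x) : R.storage s x 0 = x := h.tip_spec.2

theorem IsPortal.dep_storage (h : R.IsPortal s x) {i : ℕ} (hi : i < s) :
    R.dep (R.storage s x i) = R.dep x + i := by
  have hdep := R.dep_iterate (x := R.tip s x) (i := s - 1 - i) (by rw [h.tip_spec.1]; lia)
  rw [h.tip_spec.1] at hdep
  rw [storage]
  lia

theorem par_storage {i : ℕ} (hi : i + 1 < s) :
    R.par (R.storage s x (i + 1)) = R.storage s x i := by
  rw [storage, storage, ← Function.iterate_succ_apply' R.par]
  congr 1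
  lia

theorem IsPortal.adj_storage (h : R.IsPortal s x) {i : ℕ} (hi : i + 1 < s) :
    T.Adj (R.storage s x i) (R.storage s x (i + 1)) :=
  par_storage hi ▸ (R.adj_par _ (by rw [h.dep_storage hi]; lia)).symm

theorem IsPortal.dep_storage_mod (h : R.IsPortal s x) {i : ℕ} (hi : i < s) :
    R.dep (R.storage s x i) % s = i := by
  rw [h.dep_storage hi, Nat.add_mod, Nat.mod_eq_zero_of_dvd h.1, zero_add, Nat.mod_mod,
    Nat.mod_eq_of_lt hi]

theorem IsPortal.iterate_storage (h : R.IsPortal s x) {i : ℕ} (hi : i < s) :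
    R.par^[i] (R.storage s x i) = x := by
  rw [storage, ← Function.iterate_add_apply, show i + (s - 1 - i) = s - 1 by lia, h.tip_spec.2]

variable (R s) in
/-- The lowest ancestor of `z` whose depth is divisible by `s`, the only portal that can store
data at `z`. -/
def top (z : V) : V := R.par^[R.dep z % s] z

variable (R s) in
/-- The node `z` lies on a storage path, but is not its portal. -/
def IsStorageNode (z : V) : Prop :=
  0 < R.dep z % s ∧ R.IsPortal s (R.top s z) ∧ R.storage s (R.top s z) (R.dep z % s) = z

theorem IsPortal.top_storage (h : R.IsPortal s x) {i : ℕ} (hi : i < s) :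
    R.top s (R.storage s x i) = x := by
  rw [top, h.dep_storage_mod hi, h.iterate_storage hi]

theorem IsPortal.isStorageNode_storage (h : R.IsPortal s x) {i : ℕ} (hi : i + 1 < s) :
    R.IsStorageNode s (R.storage s x (i + 1)) := by
  rw [IsStorageNode, h.top_storage hi, h.dep_storage_mod hi]
  exact ⟨i.succ_pos, h, rfl⟩

theorem IsStorageNode.eq_of_par_eq (hx : R.IsStorageNode s x) (hy : R.IsStorageNode s y)
    (hdep : R.dep x = R.dep y) (hpar : R.par x = R.par y) : x = y := by
  have htop : R.top s x = R.top s y := by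
    obtain ⟨m, hm⟩ := Nat.exists_eq_add_of_lt hx.1
    rw [top, top, ← hdep, hm, Function.iterate_succ_apply, Function.iterate_succ_apply, hpar]
  rw [← hx.2.2, ← hy.2.2, htop, hdep]

end Rooting

end RootedTrees

section HonestLabels

variable {V : Type*} {T : SimpleGraph V}

theorem exists_walk_length_eq_dist_of_le (hT : T.IsTree) {H : SimpleGraph V} (hH : H ≤ T)
    {u v : V} (huv : H.Reachable u v) : ∃ p : H.Walk u v, p.IsPath ∧ p.length = T.dist u v := by
  obtain ⟨p, hp⟩ := huv.exists_isPath
  exact ⟨p, hp, Walk.length_mapLe hH p ▸ length_eq_dist_of_isPath hT (hp.mapLe hH)⟩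

theorem Rooting.exists_isPortal_near (R : Rooting T) (hT : T.IsTree) {s : ℕ} (hs : 0 < s)
    {H : SimpleGraph V} (hH : H ≤ T) {u v : V} (huv : H.Reachable u v) {j : ℕ}
    (hj : j + 4 * (s - 1) ≤ T.dist u v) :
    ∃ y, R.IsPortal s y ∧ T.dist y v + j ≤ T.dist u v ∧
      ∃ p : H.Walk u y, p.length ≤ j + 4 * (s - 1) := by
  obtain ⟨p, hp, hlen⟩ := exists_walk_length_eq_dist_of_le hT hH huv
  obtain ⟨i, hji, hi, hportal⟩ := R.exists_isPortal_of_isPath hs hH hp (hlen ▸ hj)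
  refine ⟨_, hportal, ?_, p.take i, by rw [Walk.take_length]; lia⟩
  have hdist := T.dist_le ((p.drop i).mapLe hH)
  rw [Walk.length_mapLe, Walk.drop_length] at hdist
  lia

/-- Two nodes of `P` are equivalent if they lie in the same component of `T_{≤ β}`. -/
def fragments {α : Type*} [Preorder α] (T : SimpleGraph V) (w : Sym2 V → α) (P : Set V) (β : α) :
    Setoid P :=
  (below T w β).reachableSetoid.comap Subtype.val

theorem exists_isRepresentativeMap_fragments [Finite V] (T : SimpleGraph V) (w : Sym2 V → ℤ)
    (P : Set V) (N : ℕ) :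
    ∃ rep : ℤ → P → P, (∀ β : ℤ, |β| ≤ N → IsRepresentativeMap (fragments T w P β) (rep β)) ∧
      ∀ J x, 2 ^ numChanges (fun j : ℕ => rep (j - N) x) J ≤ Nat.card P := by
  have hmono : Monotone fun j : ℕ => fragments T w P (j - N) := fun i j hij _ _ hxy =>
    Reachable.mono (below_mono T w (by lia)) hxy
  obtain ⟨f, hf, hchanges⟩ := exists_isRepresentativeMap_two_pow_numChanges_le hmono
  refine ⟨fun β => f (β + N).toNat, fun β hβ => ?_, by simpa using hchanges⟩
  have hlow := (abs_le.1 hβ).1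
  have hf := hf (β + N).toNat
  rwa [Int.toNat_of_nonneg (by lia), add_sub_cancel_right] at hf

/-- The set of portals for the spacing `s`. -/
def Rooting.portals (R : Rooting T) (s : ℕ) : Set V := {x | R.IsPortal s x}

theorem dist_lt_card [Finite V] {G : SimpleGraph V} (hG : G.Connected) (u v : V) :
    G.dist u v < Nat.card V := by
  have := Fintype.ofFinite V
  obtain ⟨p, hp, hlen⟩ := hG.exists_path_of_dist u v
  rw [← hlen, Nat.card_eq_fintype_card]
  exact hp.length_lt

/-- The information `info x` of every portal `x` is correct, where `id` are the identifiers and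
`rep β x` is the representative of the fragment of `x` in `T_{≤ β}`. -/
structure IsHonest {a n : ℕ} (R : Rooting T) (w : Sym2 V → ℤ) (s N : ℕ) (id : V → ℕ)
    (rep : ℤ → R.portals s → R.portals s) (info : R.portals s → PortalInfo a n) : Prop where
  depth (x : R.portals s) : ((info x).depth : ℕ) = R.dep x
  isRepresentativeMap {β : ℤ} (hβ : |β| ≤ N) :
    IsRepresentativeMap (fragments T w (R.portals s) β) (rep β)
  level_fst (x : R.portals s) {β : ℤ} (hβ : |β| ≤ N) : (((info x).level β).1 : ℕ) = id (rep β x)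
  level_snd (x : R.portals s) {β : ℤ} (hβ : |β| ≤ N) :
    (((info x).level β).2 : ℕ) = T.dist x (rep β x)

theorem exists_isHonest {n a s N : ℕ} {T : SimpleGraph (Fin n)} (hT : T.Connected)
    {R : Rooting T} (hdep : ∀ x, R.dep x < n) (w : Sym2 (Fin n) → ℤ) {id : Fin n → ℕ}
    (hid : ∀ x, id x < a) {X : Type*} {dec : X → PortalInfo a n}
    (hdec : IsPortalDecoder N (Nat.log 2 n) dec) :
    ∃ (B : R.portals s → X) (rep : ℤ → R.portals s → R.portals s),
      IsHonest R w s N id rep (dec ∘ B) := by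
  obtain ⟨rep, hrep, hchanges⟩ := exists_isRepresentativeMap_fragments T w (R.portals s) N
  have hdist (x y : Fin n) : T.dist x y < n := (dist_lt_card hT x y).trans_eq (Nat.card_fin n)
  let level (x y : R.portals s) : Fin a × Fin n := (⟨id y, hid y⟩, ⟨T.dist x y, hdist x y⟩)
  have hbits (x : R.portals s) : ∃ B, (dec B).depth = ⟨R.dep x, hdep x⟩ ∧
      ∀ β : ℤ, |β| ≤ N → (dec B).level β = level x (rep β x) := by
    have hcard : Nat.card (R.portals s) ≤ n := (Set.ncard_le_card _).trans_eq (Nat.card_fin n)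
    exact hdec _ _ ((numChanges_comp_le (level x) _ _).trans
      (Nat.le_log_of_pow_le one_lt_two ((hchanges (2 * N) x).trans hcard)))
  choose B hdepth hlevel using hbits
  exact ⟨B, rep, fun x => congrArg Fin.val (hdepth x), hrep _,
    fun x β hβ => congrArg (fun y => (y.1 : ℕ)) (hlevel x β hβ),
    fun x β hβ => congrArg (fun y => (y.2 : ℕ)) (hlevel x β hβ)⟩

/-- The labels `l` describe the rooting `R` and store, for every portal `x`, the bits `B x` along
its storage path. -/
structure IsLabeling {s b : ℕ} (R : Rooting T) (B : R.portals s → Fin s → Fin b → Bool)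
    (l : V → List Bool) : Prop where
  color (u : V) : (NodeLabel.decode (l u)).color = (R.dep u : ZMod 3)
  isPortal_iff (u : V) : (NodeLabel.decode (l u)).isPortal = true ↔ R.IsPortal s u
  isStorage_iff (u : V) : (NodeLabel.decode (l u)).isStorage = true ↔ R.IsStorageNode s u
  isRoot_iff (u : V) : (NodeLabel.decode (l u)).isRoot = true ↔ R.dep u = 0
  bits (x : R.portals s) (i : Fin s) (j : Fin b) :
    (NodeLabel.decode (l (R.storage s x i))).bits j = B x i j

theorem exists_isLabeling {s b : ℕ} (R : Rooting T) (B : R.portals s → Fin s → Fin b → Bool) :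
    ∃ l : V → List Bool, (∀ v, (l v).length = b + 5) ∧ IsLabeling R B l := by
  classical
  choose l hlen hcolor hportal hstorage hroot hbits using fun u => NodeLabel.exists_decode_eq
    { color := R.dep u
      isPortal := decide (R.IsPortal s u)
      isStorage := decide (R.IsStorageNode s u)
      isRoot := decide (R.dep u = 0)
      bits j := if h : R.top s u ∈ R.portals s ∧ R.dep u % s < s ∧ j < b then
        B ⟨_, h.1⟩ ⟨_, h.2.1⟩ ⟨_, h.2.2⟩ else false } b
  refine ⟨l, hlen, hcolor, fun u => ?_, fun u => ?_, fun u => ?_, fun ⟨x, hx⟩ i j => ?_⟩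
  · rw [hportal, decide_eq_true_iff]
  · rw [hstorage, decide_eq_true_iff]
  · rw [hroot, decide_eq_true_iff]
  · have htop := Rooting.IsPortal.top_storage hx i.2
    have hmod := Rooting.IsPortal.dep_storage_mod hx i.2
    refine (hbits _ j j.2).trans ((dif_pos ⟨htop.symm ▸ hx, hmod.symm ▸ i.2, j.2⟩).trans ?_)
    congr

end HonestLabels

section Completeness

variable {d k n a s b N r : ℕ} {c : Config MSTInput k n} {w : Sym2 (Fin n) → ℤ}
  {T : SimpleGraph (Fin n)} {l : Fin n → List Bool} {u v x : Fin n} {β : ℤ}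

theorem Encodes.dist_le_length (h : Encodes d c w T) (p : (below T w β).Walk u v) :
    c.graph.dist u v ≤ p.length :=
  (c.graph.dist_le (p.mapLe ((below_le T w β).trans h.2.1))).trans_eq (p.length_mapLe _)

theorem Encodes.reachIn_of_walk (h : Encodes d c w T) (p : (below T w β).Walk u x)
    (hp : c.graph.dist v u + p.length ≤ r) :
    ReachIn (c.view l r v).nodes β (c.viewNode l u) (c.viewNode l x) := by
  induction p using Walk.concatRec with
  | Hnil => exact .refl
  | @Hconcat u y x p hadj ih =>
    have hdist := h.dist_le_length (p.concat hadj)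
    have htriangle := c.connected.dist_triangle (u := v) (v := u) (w := x)
    rw [Walk.length_concat] at hp hdist
    exact .tail (ih (by lia))
      ⟨Config.viewNode_mem_nodes (by lia), h.markedStep_iff.2 hadj⟩

variable {R : Rooting T} {B : R.portals s → Fin s → Fin b → Bool}
  {dec : (Fin s → Fin b → Bool) → PortalInfo a n}
  {rep : ℤ → R.portals s → R.portals s}

theorem IsLabeling.color_ne (hl : IsLabeling R B l) (huv : T.Adj u v) :
    (c.viewNode l v).label.color ≠ (c.viewNode l u).label.color := by
  have hne : ∀ z : ZMod 3, z + 1 ≠ z := by decide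
  refine fun heq => ?_
  have heq : (R.dep v : ZMod 3) = R.dep u := (hl.color v).symm.trans (heq.trans (hl.color u))
  rcases R.dep_of_adj u v huv with hdep | hdep <;> rw [← hdep, Nat.cast_succ] at heq
  exacts [hne _ heq.symm, hne _ heq]

theorem IsLabeling.dep_of_parentStep (hl : IsLabeling R B l) (h : Encodes d c w T)
    (huv : ParentStep (c.viewNode l u) (c.viewNode l v)) :
    T.Adj u v ∧ R.dep v + 1 = R.dep u := by
  have hne : ∀ z : ZMod 3, z + 1 ≠ z - 1 := by decide
  have hadj := h.exists_markedStep_iff.1 huv.1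
  refine ⟨hadj, (R.dep_of_adj u v hadj).resolve_right fun hdep => ?_⟩
  have hcolor : (R.dep v : ZMod 3) = R.dep u - 1 := hl.color v ▸ hl.color u ▸ huv.2
  exact hne (R.dep u) (by rw [← hcolor, ← hdep, Nat.cast_succ])

theorem IsLabeling.dep_of_storageStep (hl : IsLabeling R B l) (h : Encodes d c w T)
    (huv : StorageStep (c.viewNode l u) (c.viewNode l v)) :
    T.Adj u v ∧ R.IsStorageNode s v ∧ R.dep u + 1 = R.dep v := by
  have hne : ∀ z : ZMod 3, z ≠ z + 1 + 1 := by decide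
  have hadj := h.exists_markedStep_iff.1 huv.1
  refine ⟨hadj, (hl.isStorage_iff v).1 huv.2.1,
    (R.dep_of_adj u v hadj).resolve_left fun hdep => ?_⟩
  have hcolor : (R.dep v : ZMod 3) = R.dep u + 1 := hl.color v ▸ hl.color u ▸ huv.2.2
  exact hne (R.dep v) (hcolor.trans (by rw [← hdep, Nat.cast_succ]))

theorem IsLabeling.eq_of_parentStep (hl : IsLabeling R B l) (h : Encodes d c w T)
    (hv : ParentStep (c.viewNode l u) (c.viewNode l v))
    (hx : ParentStep (c.viewNode l u) (c.viewNode l x)) : v = x := by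
  obtain ⟨hadj, hdep⟩ := hl.dep_of_parentStep h hv
  obtain ⟨hadj', hdep'⟩ := hl.dep_of_parentStep h hx
  exact (R.par_eq u v hadj hdep).symm.trans (R.par_eq u x hadj' hdep')

theorem IsLabeling.eq_of_storageStep (hl : IsLabeling R B l) (h : Encodes d c w T)
    (hv : StorageStep (c.viewNode l u) (c.viewNode l v))
    (hx : StorageStep (c.viewNode l u) (c.viewNode l x)) : v = x := by
  obtain ⟨hadj, hstorage, hdep⟩ := hl.dep_of_storageStep h hv
  obtain ⟨hadj', hstorage', hdep'⟩ := hl.dep_of_storageStep h hx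
  exact hstorage.eq_of_par_eq hstorage' (hdep.symm.trans hdep')
    ((R.par_eq v u hadj.symm hdep).trans (R.par_eq x u hadj'.symm hdep').symm)

theorem IsLabeling.stored (hl : IsLabeling R B l) (h : Encodes d c w T) (x : R.portals s)
    (hr : c.graph.dist v x + (s - 1) ≤ r) :
    Stored (c.view l r v).nodes dec (c.viewNode l x) (dec (B x)) := by
  have hx : R.IsPortal s x := x.2
  have hdist (i : ℕ) (hi : i < s) : c.graph.dist v (R.storage s x i) ≤ c.graph.dist v x + i := by
    induction i with
    | zero => rw [hx.storage_zero, add_zero]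
    | succ i ih =>
      have htriangle := c.connected.dist_triangle (u := v) (v := R.storage s x i)
        (w := R.storage s x (i + 1))
      rw [dist_eq_one_iff_adj.2 (h.2.1 (hx.adj_storage hi))] at htriangle
      exact htriangle.trans (Nat.succ_le_succ (ih (by lia)))
  refine ⟨(hl.isPortal_iff x).2 hx, fun i => c.viewNode l (R.storage s x i),
    congrArg _ hx.storage_zero,
    fun i hi => Config.viewNode_mem_nodes ((hdist i hi).trans (by lia)),
    fun i hi => ⟨h.exists_markedStep_iff.2 (hx.adj_storage hi),
      (hl.isStorage_iff _).2 (hx.isStorageNode_storage hi), ?_⟩,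
    congrArg dec (funext₂ fun i j => hl.bits x i j)⟩
  calc (c.viewNode l (R.storage s x (i + 1))).label.color
      = (R.dep (R.storage s x (i + 1)) : ZMod 3) := hl.color _
    _ = (R.dep (R.storage s x i) : ZMod 3) + 1 := by
      rw [hx.dep_storage hi, hx.dep_storage (Nat.lt_of_succ_lt hi)]
      push_cast
      ring
    _ = _ := by rw [← hl.color]; rfl

theorem IsLabeling.seesPortal (hl : IsLabeling R B l) (h : Encodes d c w T) (x : R.portals s)
    (p : (below T w β).Walk u x) (hr : c.graph.dist v u + p.length + (s - 1) ≤ r) :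
    SeesPortal (c.view l r v).nodes dec β (c.viewNode l u) (dec (B x)) := by
  have hdist := h.dist_le_length p
  have htriangle := c.connected.dist_triangle (u := v) (v := u) (w := x)
  exact ⟨_, h.reachIn_of_walk p (by lia), hl.stored h x (by lia)⟩

theorem IsLabeling.reachIn_or_seesPortal (hl : IsLabeling R B l) (h : Encodes d c w T)
    (hT : T.IsTree) (hs : 0 < s) (hr : 1 + 5 * (s - 1) ≤ r)
    (hB : IsHonest R w s N c.id rep (dec ∘ B)) (huv : c.graph.Adj u v) (hβ : |β| ≤ N)
    (hreach : (below T w β).Reachable u v) :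
    ReachIn (c.view l r u).nodes β (c.viewNode l u) (c.viewNode l v) ∨
      ∃ P Q, SeesPortal (c.view l r u).nodes dec β (c.viewNode l u) P ∧
        SeesPortal (c.view l r u).nodes dec β (c.viewNode l v) Q ∧
        (P.level β).1 = (Q.level β).1 := by
  have hle := below_le T w β
  obtain hlt | hlong := lt_or_ge (T.dist u v) (0 + 4 * (s - 1))
  · obtain ⟨p, -, hlen⟩ := exists_walk_length_eq_dist_of_le hT hle hreach
    exact .inl (h.reachIn_of_walk p (by rw [dist_self]; lia))
  obtain ⟨x, hx, -, p, hp⟩ := R.exists_isPortal_near hT hs hle hreach hlong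
  obtain ⟨y, hy, -, q, hq⟩ := R.exists_isPortal_near hT hs hle hreach.symm (T.dist_comm ▸ hlong)
  refine .inr ⟨_, _, hl.seesPortal h ⟨x, hx⟩ p (by rw [dist_self]; lia),
    hl.seesPortal h ⟨y, hy⟩ q (by rw [dist_eq_one_iff_adj.2 huv]; lia), Fin.ext ?_⟩
  have hxy : fragments T w (R.portals s) β ⟨x, hx⟩ ⟨y, hy⟩ :=
    (p.reachable.symm.trans hreach).trans q.reachable
  exact (hB.level_fst _ hβ).trans
    ((congrArg (c.id ∘ Subtype.val) ((hB.isRepresentativeMap hβ).eq_of_rel hxy)).trans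
      (hB.level_fst _ hβ).symm)

theorem IsLabeling.seesRoot (hl : IsLabeling R B l) (h : Encodes d c w T) (hT : T.IsTree)
    (hs : 0 < s) (hr : 1 + 5 * (s - 1) ≤ r) (hB : IsHonest R w s N c.id rep (dec ∘ B))
    {o : Fin n} (hR : ∀ x, R.dep x = T.dist o x) {D : ℕ} (hD : R.dep v ≤ D) :
    SeesRoot (c.view l r v).nodes dec D := by
  have hreach := hT.connected v o
  obtain hlt | hlong := lt_or_ge (T.dist v o) (1 + 4 * (s - 1))
  · exact ⟨_, Config.viewNode_mem_nodes ((hreach.dist_anti h.2.1).trans (by lia)),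
      .inl ((hl.isRoot_iff o).2 (by rw [hR, dist_self]))⟩
  obtain ⟨x, hx, hdist, p, hp⟩ := R.exists_isPortal_near hT hs le_rfl hreach hlong
  have hvx := (p.reachable.dist_anti h.2.1).trans (T.dist_le p)
  refine ⟨_, Config.viewNode_mem_nodes (hvx.trans (by lia)),
    .inr ⟨_, hl.stored h ⟨x, hx⟩ (by lia), ?_⟩⟩
  calc ((dec (B ⟨x, hx⟩)).depth : ℕ) = R.dep x := hB.depth ⟨x, hx⟩
    _ = T.dist x o := by rw [hR, T.dist_comm]
    _ < T.dist v o := hdist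
    _ = R.dep v := by rw [hR, T.dist_comm]
    _ ≤ D := hD

theorem IsLabeling.level_decreases (hl : IsLabeling R B l) (h : Encodes d c w T) (hT : T.IsTree)
    (hs : 0 < s) (hr : 1 + 5 * (s - 1) ≤ r) (hB : IsHonest R w s N c.id rep (dec ∘ B))
    (x : R.portals s) (hβ : |β| ≤ N) :
    c.id x = ((dec (B x)).level β).1 ∨
      ∃ Q, SeesPortal (c.view l r x).nodes dec β (c.viewNode l x) Q ∧
        (Q.level β).1 = ((dec (B x)).level β).1 ∧ (Q.level β).2 < ((dec (B x)).level β).2 := by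
  have hrep := hB.isRepresentativeMap hβ
  obtain heq | hne := eq_or_ne (rep β x) x
  · exact .inl ((congrArg (c.id ∘ Subtype.val) heq.symm).trans (hB.level_fst x hβ).symm)
  have hreach : (below T w β).Reachable x (rep β x) := hrep.rel x
  obtain ⟨y, hdist, p, hp⟩ : ∃ y : R.portals s,
      T.dist y (rep β x) + 1 ≤ T.dist x (rep β x) ∧
        ∃ p : (below T w β).Walk x y, p.length ≤ 1 + 4 * (s - 1) := by
    obtain hlt | hlong := lt_or_ge (T.dist x (rep β x)) (1 + 4 * (s - 1))
    · obtain ⟨p, -, hlen⟩ := exists_walk_length_eq_dist_of_le hT (below_le T w β) hreach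
      refine ⟨rep β x, ?_, p, by lia⟩
      rw [dist_self]
      exact hT.connected.pos_dist_of_ne (Subtype.coe_ne_coe.2 hne.symm)
    · obtain ⟨y, hy, hyx⟩ := R.exists_isPortal_near hT hs (below_le T w β) hreach hlong
      exact ⟨⟨y, hy⟩, hyx⟩
  have hxy : rep β y = rep β x := hrep.eq_of_rel (p.reachable.symm : fragments T w _ β y x)
  refine .inr ⟨_, hl.seesPortal h y p (by rw [dist_self]; lia), Fin.ext ?_, Fin.lt_def.2 ?_⟩
  · exact (hB.level_fst y hβ).trans (hxy ▸ (hB.level_fst x hβ).symm)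
  · exact (hB.level_snd y hβ).trans_lt (hxy ▸ hdist.trans_eq (hB.level_snd x hβ).symm)

theorem IsLabeling.accepts (hl : IsLabeling R B l) (h : Encodes d c w T)
    (hmst : IsMST c.graph w T) (hs : 0 < s) (hr : 1 + 5 * (s - 1) ≤ r)
    (hB : IsHonest R w s (n ^ d) c.id rep (dec ∘ B)) {o : Fin n}
    (hR : ∀ x, R.dep x = T.dist o x) (v : Fin n) :
    Accepts (n ^ d) dec (c.view l r v).nodes (c.viewNode l v) := by
  have hT := hmst.1.2
  have hnode : ∀ y ∈ (c.view l r v).nodes, ∃ u, c.viewNode l u = y := c.nodes_subset_range l r v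
  refine ⟨fun y hy β hvy => ?_, fun hroot y hy hvy => ?_, fun y hy z hz hvy hvz => ?_,
    fun y hy z hz hvy hvz => ?_, fun y hy β m hvy => ?_, ?_, fun hportal => ?_⟩
  · obtain ⟨u, rfl⟩ := hnode y hy
    exact hl.color_ne (h.markedStep_iff.1 hvy).1
  · obtain ⟨u, rfl⟩ := hnode y hy
    exact Nat.succ_ne_zero _ ((hl.dep_of_parentStep h hvy).2.trans ((hl.isRoot_iff v).1 hroot))
  · obtain ⟨⟨u, rfl⟩, ⟨x, rfl⟩⟩ := And.intro (hnode y hy) (hnode z hz)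
    exact congrArg _ (hl.eq_of_parentStep h hvy hvz)
  · obtain ⟨⟨u, rfl⟩, ⟨x, rfl⟩⟩ := And.intro (hnode y hy) (hnode z hz)
    exact congrArg _ (hl.eq_of_storageStep h hvy hvz)
  · obtain ⟨u, rfl⟩ := hnode y hy
    obtain ⟨hadj, rfl, -⟩ := h.mem_input_iff.1 hvy
    exact hl.reachIn_or_seesPortal h hT hs hr hB hadj (mod_cast h.1 _ hadj)
      (hmst.reachable_below hadj)
  · exact hl.seesRoot h hT hs hr hB hR
      ((hR v).trans_le ((dist_lt_card hT.connected o v).trans_eq (Nat.card_fin n)).le)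
  · let x : R.portals s := ⟨v, (hl.isPortal_iff v).1 hportal⟩
    exact ⟨_, hl.stored h x (by rw [dist_self]; lia),
      hl.seesRoot h hT hs hr hB hR (hB.depth x).ge,
      fun β hβ => hl.level_decreases h hT hs hr hB x hβ⟩

theorem Encodes.exists_accepts (h : Encodes d c w T) (hmst : IsMST c.graph w T) (hs : 0 < s)
    (hr : 1 + 5 * (s - 1) ≤ r) (hid : ∀ v, c.id v < a)
    (hdec : IsPortalDecoder (n ^ d) (Nat.log 2 n) dec) :
    ∃ l : Fin n → List Bool, (∀ v, (l v).length = b + 5) ∧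
      ∀ v, Accepts (n ^ d) dec (c.view l r v).nodes (c.viewNode l v) := by
  have hT := hmst.1.2
  obtain ⟨o⟩ := hT.connected.nonempty
  obtain ⟨R, hR⟩ := exists_rooting hT o
  have hdep (x : Fin n) : R.dep x < n :=
    (hR x).trans_lt ((dist_lt_card hT.connected o x).trans_eq (Nat.card_fin n))
  obtain ⟨B, rep, hB⟩ := exists_isHonest (s := s) hT.connected hdep w hid hdec
  obtain ⟨l, hlen, hl⟩ := exists_isLabeling R B
  exact ⟨l, hlen, hl.accepts h hmst hs hr hB hR⟩

end Completeness

section Schemes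

theorem mul_mul_pow_natLog_le_two_pow (k d : ℕ) {n : ℕ} (hn : 2 ≤ n) :
    n * ((n ^ k + 1) * n) * ((2 * n ^ d + 1) * ((n ^ k + 1) * n)) ^ Nat.log 2 n ≤
      2 ^ (4 * (d + 2 * k + 7) * Nat.log 2 n ^ 2) := by
  set L := Nat.log 2 n
  have hL : 1 ≤ L := Nat.log_pos one_lt_two hn
  have hpow (m : ℕ) : n ^ m ≤ 2 ^ ((L + 1) * m) := by
    rw [pow_mul]
    exact Nat.pow_le_pow_left (Nat.lt_pow_succ_log_self one_lt_two n).le m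
  have hone (m : ℕ) : 1 ≤ 2 ^ m := Nat.one_le_two_pow
  have hn : n ≤ 2 ^ (L + 1) := by simpa using hpow 1
  have hid : n ^ k + 1 ≤ 2 ^ ((L + 1) * k + 1) := by
    rw [pow_succ]
    linarith [hpow k, hone ((L + 1) * k)]
  have hweight : 2 * n ^ d + 1 ≤ 2 ^ ((L + 1) * d + 2) := by
    rw [pow_add]
    linarith [hpow d, hone ((L + 1) * d)]
  calc n * ((n ^ k + 1) * n) * ((2 * n ^ d + 1) * ((n ^ k + 1) * n)) ^ L
      ≤ 2 ^ (L + 1) * (2 ^ ((L + 1) * k + 1) * 2 ^ (L + 1)) *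
        (2 ^ ((L + 1) * d + 2) * (2 ^ ((L + 1) * k + 1) * 2 ^ (L + 1))) ^ L := by gcongr
    _ = 2 ^ ((L + 1) + ((L + 1) * k + 1 + (L + 1)) +
        ((L + 1) * d + 2 + ((L + 1) * k + 1 + (L + 1))) * L) := by
      simp only [← pow_add, ← pow_mul]
    _ ≤ 2 ^ (4 * (d + 2 * k + 7) * L ^ 2) := by
      refine Nat.pow_le_pow_right two_pos ?_
      obtain ⟨m, hm⟩ := Nat.exists_eq_add_of_le' hL
      rw [hm]
      ring_nf
      lia

theorem natLog_sq_le_mul_ceil (c n : ℕ) {t : ℕ} (ht : 1 ≤ t) :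
    c * Nat.log 2 n ^ 2 ≤ ((t - 1) / 5 + 1) * (5 * c * ⌈Real.logb 2 n ^ 2 / t⌉₊) := by
  have hlog : Nat.log 2 n ^ 2 ≤ ⌈Real.logb 2 n ^ 2 / t⌉₊ * t := by
    have hceil := (div_le_iff₀ (Nat.cast_pos.2 ht)).1 (Nat.le_ceil (Real.logb 2 n ^ 2 / t))
    exact_mod_cast (pow_le_pow_left₀ (Nat.cast_nonneg _) (Real.natLog_le_logb n 2) 2).trans hceil
  calc c * Nat.log 2 n ^ 2
      ≤ c * (⌈Real.logb 2 n ^ 2 / t⌉₊ * (5 * ((t - 1) / 5 + 1))) := by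
        gcongr
        exact hlog.trans (Nat.mul_le_mul_left _ (by lia))
    _ = _ := by ring

theorem logb_two_sq_le_pow_three (n : ℕ) : Real.logb 2 n ^ 2 ≤ Real.logb 2 n ^ 3 := by
  obtain hn | hn := Nat.lt_or_ge n 2
  · interval_cases n <;> simp
  · refine pow_le_pow_right₀ ?_ (by lia)
    rw [Real.le_logb_iff_rpow_le one_lt_two (by positivity)]
    simpa using hn

/-- On configurations with `n` nodes, a verifier of radius `t` separates `P` from the rest of `F`
by labels of at most `b` bits. -/
def HasVerifier {Input : Type} {k n : ℕ} (F P : Set (Config Input k n)) (t b : ℕ) : Prop :=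
  ∃ A : View Input → Prop,
    (∀ c ∈ P, ∃ l : Fin n → List Bool, (∀ v, (l v).length ≤ b) ∧ ∀ v, A (c.view l t v)) ∧
    ∀ c ∈ F, ∀ l, (∀ v, A (c.view l t v)) → c ∈ P

-- A view contains the number of nodes, so one verifier can serve all sizes.
theorem PLS.exists_cost_le {Input : Type} {k : ℕ} {F P : ∀ n, Set (Config Input k n)}
    {t b : ℕ → ℕ} (h : ∀ n, HasVerifier (F n) (P n) (t n) (b n)) :
    ∃ S : PLS F P t, ∀ n, S.cost n ≤ b n := by
  classical
  choose A hcomplete hsound using h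
  choose l hlen hacc using hcomplete
  refine ⟨⟨fun {n} c => if hc : c ∈ P n then l n c hc else fun _ => [],
    fun x => decide (A x.size x), fun {n} c hc v => ?_,
    fun {n} c hc l hver => hsound n c hc l fun v => of_decide_eq_true (hver v)⟩,
    fun n => iSup₂_le fun c hc => iSup_le fun v => ?_⟩
  · simp only [dif_pos hc]
    exact decide_eq_true (hacc n c hc v)
  · simp only [dif_pos hc]
    exact_mod_cast hlen n c hc v

theorem hasVerifier_mst_of_le_one {k d n : ℕ} (hn : n ≤ 1) (t b : ℕ) :
    HasVerifier (mstFamily k d n) (mstPredicate k d n) t b := by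
  refine ⟨fun _ => True, fun _ _ => ⟨fun _ => [], by simp, fun _ => trivial⟩, ?_⟩
  rintro c ⟨w, T, h⟩ - -
  have := c.connected.nonempty
  have : Subsingleton (Fin n) := Fin.subsingleton_iff_le_one.2 hn
  exact ⟨w, T, h, ⟨h.2.1, .of_subsingleton⟩, fun T' _ => by rw [Subsingleton.elim T T']⟩

theorem hasVerifier_mst_of_isPortalDecoder {k d n s b t : ℕ} (hs : 0 < s)
    (ht : 1 + 5 * (s - 1) ≤ t)
    {dec : (Fin s → Fin b → Bool) → PortalInfo (n ^ k + 1) n}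
    (hdec : IsPortalDecoder (n ^ d) (Nat.log 2 n) dec) :
    HasVerifier (mstFamily k d n) (mstPredicate k d n) t (b + 5) := by
  refine ⟨fun x => ∃ y ∈ x.nodes, y.1 = x.center ∧ Accepts (n ^ d) dec x.nodes y, ?_, ?_⟩
  · rintro c ⟨w, T, h, hmst⟩
    obtain ⟨l, hlen, hacc⟩ :=
      h.exists_accepts hmst hs ht (fun v => Nat.lt_succ_of_le (c.id_le v)) hdec
    exact ⟨l, fun v => (hlen v).le,
      fun v => ⟨_, Config.viewNode_mem_nodes (by rw [dist_self]; lia), rfl, hacc v⟩⟩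
  · rintro c ⟨w, T, h⟩ l hacc
    refine ⟨w, T, h, h.isMST_of_accepts (dec := dec) (l := l) (r := t) (by lia) fun v => ?_⟩
    obtain ⟨_, ⟨u, -, rfl⟩, hid, hu⟩ := hacc v
    obtain rfl : u = v := c.id_injective hid
    exact hu

theorem hasVerifier_mst_of_two_le (k d : ℕ) {n t : ℕ} (hn : 2 ≤ n) (ht : 1 ≤ t) :
    HasVerifier (mstFamily k d n) (mstPredicate k d n) t
      (20 * (d + 2 * k + 7) * ⌈Real.logb 2 n ^ 2 / t⌉₊ + 5) := by
  set q := ⌈Real.logb 2 n ^ 2 / t⌉₊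
  have : NeZero n := ⟨by lia⟩
  have hcard : n * ((n ^ k + 1) * n) * ((2 * n ^ d + 1) * ((n ^ k + 1) * n)) ^ Nat.log 2 n ≤
      Fintype.card (Fin ((t - 1) / 5 + 1) → Fin (20 * (d + 2 * k + 7) * q) → Bool) :=
    calc _ ≤ 2 ^ (4 * (d + 2 * k + 7) * Nat.log 2 n ^ 2) := mul_mul_pow_natLog_le_two_pow k d hn
      _ ≤ 2 ^ (((t - 1) / 5 + 1) * (5 * (4 * (d + 2 * k + 7)) * q)) :=
        Nat.pow_le_pow_right two_pos (natLog_sq_le_mul_ceil _ n ht)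
      _ = _ := by
        simp only [Fintype.card_fun, Fintype.card_bool, Fintype.card_fin, ← pow_mul]
        ring_nf
  obtain ⟨dec, hdec⟩ := exists_isPortalDecoder hcard
  exact hasVerifier_mst_of_isPortalDecoder (Nat.succ_pos _) (by lia) hdec

theorem hasVerifier_mst (k d : ℕ) {n t : ℕ} (ht : 1 ≤ n → 1 ≤ t) :
    HasVerifier (mstFamily k d n) (mstPredicate k d n) t
      ((20 * (d + 2 * k + 7) + 5) * ⌈Real.logb 2 n ^ 2 / t⌉₊) := by
  obtain hn | hn := le_or_gt n 1
  · exact hasVerifier_mst_of_le_one hn _ _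
  have ht := ht hn.le
  have hlog : 0 < Real.logb 2 n := Real.logb_pos one_lt_two (mod_cast hn)
  have hceil : 1 ≤ ⌈Real.logb 2 n ^ 2 / t⌉₊ := Nat.ceil_pos.2 (by positivity)
  obtain ⟨A, hcomplete, hsound⟩ := hasVerifier_mst_of_two_le k d hn ht
  refine ⟨A, fun c hc => ?_, hsound⟩
  obtain ⟨l, hlen, hacc⟩ := hcomplete c hc
  exact ⟨l, fun v => (hlen v).trans (by lia), hacc⟩

end Schemes

end ProofLabeling

theorem mainTheorem4_general (k d : ℕ) :
    ∃ C : ℕ, ∀ t : ℕ → ℕ, (∀ n, 1 ≤ n → 1 ≤ t n) →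
      ∃ S : ProofLabeling.PLS (ProofLabeling.mstFamily k d) (ProofLabeling.mstPredicate k d) t,
        ∀ n, 1 ≤ n → S.cost n ≤ ((C * ⌈Real.logb 2 n ^ 2 / t n⌉₊ : ℕ) : ℕ∞) := by
  refine ⟨20 * (d + 2 * k + 7) + 5, fun t ht => ?_⟩
  obtain ⟨S, hS⟩ := ProofLabeling.PLS.exists_cost_le fun n =>
    ProofLabeling.hasVerifier_mst k d (ht n)
  exact ⟨S, fun n _ => hS n⟩

theorem mainTheorem4 (k d : ℕ) :
    ∃ C : ℕ, ∀ t : ℕ → ℕ, (∀ n, 1 ≤ n → 1 ≤ t n ∧ Real.logb 2 n ≤ t n) →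
      ∃ S : ProofLabeling.PLS (ProofLabeling.mstFamily k d) (ProofLabeling.mstPredicate k d) t,
        ∀ n, 1 ≤ n → S.cost n ≤ ((C * ⌈Real.logb 2 n ^ 3 / t n⌉₊ : ℕ) : ℕ∞) := by
  obtain ⟨C, hC⟩ := mainTheorem4_general k d
  refine ⟨C, fun t ht => (hC t fun n hn => (ht n hn).1).imp fun S hS n hn => (hS n hn).trans ?_⟩
  exact_mod_cast Nat.mul_le_mul_left C (Nat.ceil_mono
    (div_le_div_of_nonneg_right (ProofLabeling.logb_two_sq_le_pow_three n) (Nat.cast_nonneg _)))
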